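/- Let $n\ge 0$, let $(\Sigma^n,h)$ be a smooth $n$-dimensional manifold (without boundary) with a Riemannian metric $h$ of class $C^2$, and let $V>0$ be a function of class $C^3$ on $\Sigma$ such that $(\Sigma,h,\sqrt V)$ is a static solution, i.e. $$\Delta\sqrt V=n\sqrt V,\qquad \mathrm{Ric}[h]+n\,h=(\sqrt V)^{-1}\nabla^2\sqrt V \quad\text{on }\Sigma,$$ where $\nabla$, $\nabla^2$ and $\Delta=\mathrm{tr}_h\nabla^2$ are the gradient, Hessian and Laplace–Beltrami operator of $h$. Then the function $$W=V-|\nabla\sqrt V|^2-1$$ is of class $C^2$ and satisfies, on all of $\Sigma$, $$-\Delta W=2\,\bigl|\nabla^2\sqrt V-\sqrt V\,h\bigr|^2-\frac{\nabla\sqrt V}{\sqrt V}\cdot\nabla W .$$ -/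

import Mathlib

open scoped Manifold ContDiff
open Bundle

noncomputable section

namespace StaticSolution

/-! ## Riemannian geometry in coordinates

`G : ℝⁿ → Matrix` is the matrix `(h_ij)` of components of a metric in some coordinate system. -/

section Coordinates

variable {n : ℕ}

/-- The partial derivative `∂_i F` at `y`. -/
def pd (i : Fin n) (F : EuclideanSpace ℝ (Fin n) → ℝ) (y : EuclideanSpace ℝ (Fin n)) : ℝ :=
  fderiv ℝ F y (EuclideanSpace.single i 1)

/-- The Christoffel symbols
`Γ^k_ij = ½ ∑_l h^{kl} (∂_i h_jl + ∂_j h_il - ∂_l h_ij)`. -/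
def christoffel (G : EuclideanSpace ℝ (Fin n) → Matrix (Fin n) (Fin n) ℝ) (k i j : Fin n)
    (y : EuclideanSpace ℝ (Fin n)) : ℝ :=
  1 / 2 * ∑ l, (G y)⁻¹ k l *
    (pd i (fun z => G z j l) y + pd j (fun z => G z i l) y - pd l (fun z => G z i j) y)

/-- The components of the Hessian, `(∇²f)_ij = ∂_i ∂_j f - ∑_k Γ^k_ij ∂_k f`. -/
def hessianCoord (G : EuclideanSpace ℝ (Fin n) → Matrix (Fin n) (Fin n) ℝ)
    (f : EuclideanSpace ℝ (Fin n) → ℝ) (y : EuclideanSpace ℝ (Fin n)) :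
    Matrix (Fin n) (Fin n) ℝ :=
  Matrix.of fun i j => pd i (pd j f) y - ∑ k, christoffel G k i j y * pd k f y

/-- The components of the Ricci tensor,
`R_ij = ∑_k (∂_k Γ^k_ij - ∂_j Γ^k_ik) + ∑_{k,l} (Γ^k_kl Γ^l_ij - Γ^k_jl Γ^l_ik)`
(so that round spheres have positive Ricci curvature). -/
def ricciCoord (G : EuclideanSpace ℝ (Fin n) → Matrix (Fin n) (Fin n) ℝ)
    (y : EuclideanSpace ℝ (Fin n)) : Matrix (Fin n) (Fin n) ℝ :=
  Matrix.of fun i j =>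
    ∑ k, (pd k (christoffel G k i j) y - pd j (christoffel G k i k) y) +
      ∑ k, ∑ l, (christoffel G k k l y * christoffel G l i j y -
        christoffel G k j l y * christoffel G l i k y)

end Coordinates

/-! ## Riemannian geometry on a manifold -/

section Manifold

variable {n : ℕ} {M : Type*} [TopologicalSpace M] [ChartedSpace (EuclideanSpace ℝ (Fin n)) M]
  [IsManifold (𝓡 n) ∞ M]

/-- A Riemannian metric of class `C^2` on the tangent bundle of an `n`-manifold. -/
abbrev Metric (n : ℕ) (M : Type*) [TopologicalSpace M]
    [ChartedSpace (EuclideanSpace ℝ (Fin n)) M] [IsManifold (𝓡 n) ∞ M] :=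
  ContMDiffRiemannianMetric (𝓡 n) 2 (EuclideanSpace ℝ (Fin n))
    (fun p : M => TangentSpace (𝓡 n) p)

/-- The metric at the point `p` as a bilinear form on the tangent space. -/
def metricForm (h : Metric n M) (p : M) : LinearMap.BilinForm ℝ (TangentSpace (𝓡 n) p) :=
  LinearMap.mk₂ ℝ (fun v w => h.inner p v w) (by simp) (by simp) (by simp) (by simp)

instance (p : M) : FiniteDimensional ℝ (TangentSpace (𝓡 n) p) :=
  inferInstanceAs (FiniteDimensional ℝ (EuclideanSpace ℝ (Fin n)))

theorem metricForm_nondegenerate (h : Metric n M) (p : M) : (metricForm h p).Nondegenerate := by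
  constructor
  · intro v hv
    by_contra hne
    exact (h.pos p v hne).ne' (hv v)
  · intro v hv
    by_contra hne
    exact (h.pos p v hne).ne' (hv v)

/-- The gradient `∇f` at `p`: the tangent vector with `h(∇f, w) = df(w)` for all `w`. -/
def grad (h : Metric n M) (f : M → ℝ) (p : M) : TangentSpace (𝓡 n) p :=
  ((metricForm h p).toDual (metricForm_nondegenerate h p)).symm
    (mfderiv (𝓡 n) 𝓘(ℝ, ℝ) f p).toLinearMap

theorem inner_grad (h : Metric n M) (f : M → ℝ) (p : M) (w : TangentSpace (𝓡 n) p) :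
    h.inner p (grad h f p) w = mfderiv (𝓡 n) 𝓘(ℝ, ℝ) f p w :=
  LinearMap.BilinForm.apply_toDual_symm_apply (hB := metricForm_nondegenerate h p)
    (mfderiv (𝓡 n) 𝓘(ℝ, ℝ) f p).toLinearMap w

/-- The components `h_ij = h(∂_i, ∂_j)` of the metric in the coordinates of the chart `e`,
as functions on `e.target ⊆ ℝⁿ`. -/
def metricCoord (h : Metric n M) (e : OpenPartialHomeomorph M (EuclideanSpace ℝ (Fin n)))
    (y : EuclideanSpace ℝ (Fin n)) : Matrix (Fin n) (Fin n) ℝ :=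
  Matrix.of fun i j => h.inner (e.symm y)
    (mfderiv (𝓡 n) (𝓡 n) e.symm y (EuclideanSpace.single i (1 : ℝ)))
    (mfderiv (𝓡 n) (𝓡 n) e.symm y (EuclideanSpace.single j (1 : ℝ)))

/-- The matrix `(h_ij)` at the point `p`, in the chart `e`. -/
def metricMatrix (h : Metric n M) (e : OpenPartialHomeomorph M (EuclideanSpace ℝ (Fin n)))
    (p : M) : Matrix (Fin n) (Fin n) ℝ :=
  metricCoord h e (e p)

/-- The components of the Hessian `∇²f` at the point `p`, in the chart `e`. -/
def hessian (h : Metric n M) (e : OpenPartialHomeomorph M (EuclideanSpace ℝ (Fin n)))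
    (f : M → ℝ) (p : M) : Matrix (Fin n) (Fin n) ℝ :=
  hessianCoord (metricCoord h e) (f ∘ e.symm) (e p)

/-- The components of the Ricci tensor at the point `p`, in the chart `e`. -/
def ricci (h : Metric n M) (e : OpenPartialHomeomorph M (EuclideanSpace ℝ (Fin n)))
    (p : M) : Matrix (Fin n) (Fin n) ℝ :=
  ricciCoord (metricCoord h e) (e p)

/-- The Laplace-Beltrami operator `Δf = ∑ h^{ij} (∇²f)_ij` at `p`, computed in the chart `e`. -/
def laplacian (h : Metric n M) (e : OpenPartialHomeomorph M (EuclideanSpace ℝ (Fin n)))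
    (f : M → ℝ) (p : M) : ℝ :=
  ∑ i, ∑ j, (metricMatrix h e p)⁻¹ i j * hessian h e f p i j

/-- The squared norm `|T|² = ∑ h^{ik} h^{jl} T_ij T_kl` of a covariant 2-tensor at `p` with
components `T_ij` in the chart `e`. -/
def tensorNormSq (h : Metric n M) (e : OpenPartialHomeomorph M (EuclideanSpace ℝ (Fin n)))
    (p : M) (T : Matrix (Fin n) (Fin n) ℝ) : ℝ :=
  ∑ i, ∑ j, ∑ k, ∑ l,
    (metricMatrix h e p)⁻¹ i k * (metricMatrix h e p)⁻¹ j l * T i j * T k l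

/-- `(M, h, √V)` is a static solution: `V > 0` and
`Δ√V = n √V`, `Ric[h] + n h = (√V)⁻¹ ∇²√V`.
As equations between tensors, these are imposed on the components in every chart of the
(smooth) maximal atlas, at every point of the domain of the chart. -/
structure IsStatic (h : Metric n M) (V : M → ℝ) : Prop where
  contMDiff : ContMDiff (𝓡 n) 𝓘(ℝ, ℝ) 3 V
  pos : ∀ p, 0 < V p
  laplacian_eq : ∀ e ∈ IsManifold.maximalAtlas (𝓡 n) ∞ M, ∀ p ∈ e.source,
    laplacian h e (fun q => √(V q)) p = n * √(V p)
  ricci_eq : ∀ e ∈ IsManifold.maximalAtlas (𝓡 n) ∞ M, ∀ p ∈ e.source,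
    ricci h e p + (n : ℝ) • metricMatrix h e p =
      (√(V p))⁻¹ • hessian h e (fun q => √(V q)) p

/-- The function `W = V - |∇√V|² - 1`. -/
def W (h : Metric n M) (V : M → ℝ) (p : M) : ℝ :=
  V p - h.inner p (grad h (fun q => √(V q)) p) (grad h (fun q => √(V q)) p) - 1

end Manifold

end StaticSolution

end

/-!
In a chart the statement is a Bochner-type identity for `u = √V`. Write `X = ∇u` and let
`A = ∇X` be the endomorphism `A^i_l = ∇_l X^i = ∑_j h^{ij} (∇²u)_lj`. Since
`W = u² - |∇u|² - 1`, its gradient is `2 u X - 2 A X`, so that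

  `ΔW = div (2 u X - 2 A X) = 2 |∇u|² + 2 u tr A - 2 (div A)(X) - 2 tr A²`

(`div_raise_pd_coordW`). The contracted Ricci identity `div A = d (tr A) + Ric(X, ·)`
(`div_covDeriv`) and the static equations `tr A = n u`, `Ric = u⁻¹ ∇²u - n h` give
`div A = u⁻¹ ∇²u(X, ·)`, because the two multiples of `du` cancel. On the other side
`|∇²u - u h|² = tr A² - 2 u tr A + n u²` (`sum_inv_mul_inv_mul`) and
`⟨X, ∇W⟩ = 2 u |X|² - 2 ∇²u(X, X)` (`pd_coordW`); comparing the two sides is then algebra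
(`laplacian_coordW`).

The computation uses at most two derivatives of the metric and three of `u`: the components
`X^i` are `C²` and the Christoffel symbols and `A` are `C¹`. Everything about the metric enters
through the compatibility of the connection (`pd_metric`), in the form that raising an index
commutes with covariant differentiation (`covDeriv_raise`); this way the inverse matrix is never
differentiated explicitly.

The rest transfers the intrinsic objects to a chart: the components of `h` are `C²` and
nondegenerate (`isMetricOn_metricCoord`), and the gradient is the differential with its index
raised (`grad_eq`). The regularity of `W` is read off from its coordinate expression.
-/

namespace StaticSolution

/-! ### Partial derivatives -/

section PartialDerivatives

variable {n : ℕ} {U : Set (EuclideanSpace ℝ (Fin n))} {y : EuclideanSpace ℝ (Fin n)}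

theorem pd_congr {F F' : EuclideanSpace ℝ (Fin n) → ℝ} (hU : IsOpen U) (hy : y ∈ U)
    (h : ∀ z ∈ U, F z = F' z) (k : Fin n) : pd k F y = pd k F' y := by
  have : F =ᶠ[nhds y] F' := Filter.eventually_of_mem (hU.mem_nhds hy) h
  rw [pd, pd, this.fderiv_eq]

theorem pd_add {F F' : EuclideanSpace ℝ (Fin n) → ℝ} (hF : DifferentiableAt ℝ F y)
    (hF' : DifferentiableAt ℝ F' y) (k : Fin n) :
    pd k (fun z => F z + F' z) y = pd k F y + pd k F' y := by
  simp [pd, fderiv_fun_add hF hF']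

theorem pd_sub {F F' : EuclideanSpace ℝ (Fin n) → ℝ} (hF : DifferentiableAt ℝ F y)
    (hF' : DifferentiableAt ℝ F' y) (k : Fin n) :
    pd k (fun z => F z - F' z) y = pd k F y - pd k F' y := by
  simp [pd, fderiv_fun_sub hF hF']

theorem pd_const_mul {F : EuclideanSpace ℝ (Fin n) → ℝ} (c : ℝ)
    (hF : DifferentiableAt ℝ F y) (k : Fin n) :
    pd k (fun z => c * F z) y = c * pd k F y := by
  simp [pd, fderiv_const_mul hF]

theorem pd_mul {F F' : EuclideanSpace ℝ (Fin n) → ℝ} (hF : DifferentiableAt ℝ F y)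
    (hF' : DifferentiableAt ℝ F' y) (k : Fin n) :
    pd k (fun z => F z * F' z) y = pd k F y * F' y + F y * pd k F' y := by
  simp [pd, fderiv_fun_mul hF hF']
  ring

theorem pd_sum {ι : Type*} [Fintype ι] {F : ι → EuclideanSpace ℝ (Fin n) → ℝ}
    (hF : ∀ l, DifferentiableAt ℝ (F l) y) (k : Fin n) :
    pd k (fun z => ∑ l, F l z) y = ∑ l, pd k (F l) y := by
  simp [pd, fderiv_fun_sum (fun l _ => hF l)]

theorem pd_sum_mul {ι : Type*} [Fintype ι] {F F' : ι → EuclideanSpace ℝ (Fin n) → ℝ}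
    (hF : ∀ l, DifferentiableAt ℝ (F l) y) (hF' : ∀ l, DifferentiableAt ℝ (F' l) y)
    (k : Fin n) :
    pd k (fun z => ∑ l, F l z * F' l z) y =
      ∑ l, (pd k (F l) y * F' l y + F l y * pd k (F' l) y) := by
  rw [pd_sum fun l => (hF l).fun_mul (hF' l)]
  exact Finset.sum_congr rfl fun l _ => pd_mul (hF l) (hF' l) k

theorem contDiffOn_pd {F : EuclideanSpace ℝ (Fin n) → ℝ} {m m' : WithTop ℕ∞} (hU : IsOpen U)
    (hF : ContDiffOn ℝ m' F U) (hm : m + 1 ≤ m') (k : Fin n) : ContDiffOn ℝ m (pd k F) U :=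
  (hF.fderiv_of_isOpen hU hm).clm_apply contDiffOn_const

theorem pd_comm {F : EuclideanSpace ℝ (Fin n) → ℝ} (hU : IsOpen U) (hy : y ∈ U)
    (hF : ContDiffOn ℝ 2 F U) (i j : Fin n) : pd i (pd j F) y = pd j (pd i F) y := by
  have hFy : ContDiffAt ℝ 2 F y := hF.contDiffAt (hU.mem_nhds hy)
  have hd : DifferentiableAt ℝ (fderiv ℝ F) y :=
    (hFy.fderiv_right (m := 1) (by norm_num)).differentiableAt (by norm_num)
  have hsymm : IsSymmSndFDerivAt ℝ F y := hFy.isSymmSndFDerivAt (by simp)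
  have key : ∀ a b : Fin n, pd a (pd b F) y =
      fderiv ℝ (fderiv ℝ F) y (EuclideanSpace.single a 1) (EuclideanSpace.single b 1) := by
    intro a b
    change fderiv ℝ (fun z => fderiv ℝ F z (EuclideanSpace.single b 1)) y _ = _
    rw [fderiv_clm_apply hd (differentiableAt_const _)]
    simp
  rw [key, key, hsymm.eq]

end PartialDerivatives

/-! ### Tensor calculus in a coordinate system -/

section Coordinates

variable {n : ℕ} {G : EuclideanSpace ℝ (Fin n) → Matrix (Fin n) (Fin n) ℝ}
  {U : Set (EuclideanSpace ℝ (Fin n))} {y : EuclideanSpace ℝ (Fin n)}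

/-- `G` is the matrix of a nondegenerate symmetric `C^2` metric on the open set `U`. Positivity
plays no role in the tensor calculus. -/
structure IsMetricOn (G : EuclideanSpace ℝ (Fin n) → Matrix (Fin n) (Fin n) ℝ)
    (U : Set (EuclideanSpace ℝ (Fin n))) : Prop where
  isOpen : IsOpen U
  contDiffOn : ∀ i j, ContDiffOn ℝ 2 (fun z => G z i j) U
  symm : ∀ z i j, G z i j = G z j i
  isUnit_det : ∀ z ∈ U, IsUnit (G z).det

/-- The vector field `∑_j h^{ij} η_j` obtained from the 1-form `η` by raising its index. -/
noncomputable def raise (G : EuclideanSpace ℝ (Fin n) → Matrix (Fin n) (Fin n) ℝ)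
    (η : Fin n → EuclideanSpace ℝ (Fin n) → ℝ) (i : Fin n) (z : EuclideanSpace ℝ (Fin n)) : ℝ :=
  ∑ j, (G z)⁻¹ i j * η j z

/-- The covariant derivative `∇_k X^i = ∂_k X^i + ∑_l Γ^i_kl X^l` of a vector field. -/
noncomputable def covDeriv (G : EuclideanSpace ℝ (Fin n) → Matrix (Fin n) (Fin n) ℝ)
    (X : Fin n → EuclideanSpace ℝ (Fin n) → ℝ) (i k : Fin n) (z : EuclideanSpace ℝ (Fin n)) : ℝ :=
  pd k (X i) z + ∑ l, christoffel G i k l z * X l z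

namespace IsMetricOn

theorem contDiffOn_det (hG : IsMetricOn G U) : ContDiffOn ℝ 2 (fun z => (G z).det) U := by
  simp only [Matrix.det_apply, Units.smul_def, zsmul_eq_mul]
  exact ContDiffOn.sum fun σ _ => contDiffOn_const.mul
    (contDiffOn_prod fun i _ => hG.contDiffOn _ _)

theorem contDiffOn_inv (hG : IsMetricOn G U) (i j : Fin n) :
    ContDiffOn ℝ 2 (fun z => (G z)⁻¹ i j) U := by
  simp only [Matrix.inv_def, Ring.inverse_eq_inv', Matrix.smul_apply, smul_eq_mul,
    Matrix.adjugate_apply]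
  refine (hG.contDiffOn_det.inv fun z hz => (hG.isUnit_det z hz).ne_zero).mul ?_
  simp only [Matrix.det_apply, Units.smul_def, zsmul_eq_mul]
  refine ContDiffOn.sum fun σ _ => contDiffOn_const.mul (contDiffOn_prod fun l _ => ?_)
  simp only [Matrix.updateRow_apply]
  split_ifs
  · exact contDiffOn_const
  · exact hG.contDiffOn _ _

theorem contDiffOn_christoffel (hG : IsMetricOn G U) (k i j : Fin n) :
    ContDiffOn ℝ 1 (christoffel G k i j) U := by
  have hpd : ∀ a b c, ContDiffOn ℝ 1 (pd a fun z => G z b c) U := fun a b c =>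
    contDiffOn_pd hG.isOpen (hG.contDiffOn b c) (by norm_num) a
  refine contDiffOn_const.mul (ContDiffOn.sum fun l _ => ?_)
  exact ((hG.contDiffOn_inv k l).of_le (by norm_num)).mul
    (((hpd i j l).add (hpd j i l)).sub (hpd l i j))

theorem contDiffOn_raise (hG : IsMetricOn G U) {m : WithTop ℕ∞} (hm : m ≤ 2)
    {η : Fin n → EuclideanSpace ℝ (Fin n) → ℝ} (hη : ∀ j, ContDiffOn ℝ m (η j) U) (i : Fin n) :
    ContDiffOn ℝ m (raise G η i) U :=
  ContDiffOn.sum fun j _ => ((hG.contDiffOn_inv i j).of_le hm).mul (hη j)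

theorem contDiffOn_covDeriv (hG : IsMetricOn G U)
    {X : Fin n → EuclideanSpace ℝ (Fin n) → ℝ} (hX : ∀ j, ContDiffOn ℝ 2 (X j) U) (i k : Fin n) :
    ContDiffOn ℝ 1 (covDeriv G X i k) U :=
  (contDiffOn_pd hG.isOpen (hX i) (by norm_num) k).add
    (ContDiffOn.sum fun l _ => (hG.contDiffOn_christoffel i k l).mul
      ((hX l).of_le (by norm_num)))

theorem differentiableAt (hG : IsMetricOn G U) {F : EuclideanSpace ℝ (Fin n) → ℝ}
    {m : WithTop ℕ∞} (hF : ContDiffOn ℝ m F U) (hy : y ∈ U) (hm : m ≠ 0) :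
    DifferentiableAt ℝ F y :=
  (hF.contDiffAt (hG.isOpen.mem_nhds hy)).differentiableAt hm

theorem inv_symm (hG : IsMetricOn G U) (z : EuclideanSpace ℝ (Fin n)) (i j : Fin n) :
    (G z)⁻¹ i j = (G z)⁻¹ j i := by
  have h : (G z).transpose = G z := by ext a b; exact hG.symm z b a
  conv_lhs => rw [← h, ← Matrix.transpose_nonsing_inv]
  rfl

theorem sum_inv_mul_sum (hG : IsMetricOn G U) (hy : y ∈ U) (c : Fin n → ℝ) (i : Fin n) :
    ∑ j, (G y)⁻¹ i j * ∑ m, G y j m * c m = c i := by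
  have : (G y)⁻¹.mulVec ((G y).mulVec c) = c := by
    rw [Matrix.mulVec_mulVec, Matrix.nonsing_inv_mul _ (hG.isUnit_det y hy), Matrix.one_mulVec]
  exact congrFun this i

theorem sum_mul_sum_inv (hG : IsMetricOn G U) (hy : y ∈ U) (c : Fin n → ℝ) (i : Fin n) :
    ∑ j, G y i j * ∑ m, (G y)⁻¹ j m * c m = c i := by
  have : (G y).mulVec ((G y)⁻¹.mulVec c) = c := by
    rw [Matrix.mulVec_mulVec, Matrix.mul_nonsing_inv _ (hG.isUnit_det y hy), Matrix.one_mulVec]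
  exact congrFun this i

theorem christoffel_symm (hG : IsMetricOn G U) (k i j : Fin n) (z : EuclideanSpace ℝ (Fin n)) :
    christoffel G k i j z = christoffel G k j i z := by
  have h : (fun z => G z i j) = fun z => G z j i := funext fun z => hG.symm z i j
  simp only [christoffel, ← h]
  congr 1
  exact Finset.sum_congr rfl fun l _ => by ring

theorem sum_mul_christoffel (hG : IsMetricOn G U) (hy : y ∈ U) (m i j : Fin n) :
    ∑ l, G y m l * christoffel G l i j y =
      1 / 2 * (pd i (fun z => G z j m) y + pd j (fun z => G z i m) y -
        pd m (fun z => G z i j) y) := by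
  rw [← hG.sum_mul_sum_inv hy (fun m => pd i (fun z => G z j m) y + pd j (fun z => G z i m) y -
        pd m (fun z => G z i j) y) m, Finset.mul_sum]
  refine Finset.sum_congr rfl fun l _ => ?_
  rw [christoffel]
  ring

/-- The Levi-Civita connection is compatible with the metric. -/
theorem pd_metric (hG : IsMetricOn G U) (hy : y ∈ U) (k a b : Fin n) :
    pd k (fun z => G z a b) y =
      ∑ l, (christoffel G l k a y * G y l b + G y a l * christoffel G l k b y) := by
  have h : ∀ c d, (fun z => G z c d) = fun z => G z d c := fun c d =>
    funext fun z => hG.symm z c d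
  have h1 : ∀ l, christoffel G l k a y * G y l b = G y b l * christoffel G l k a y := fun l => by
    rw [hG.symm y l b, mul_comm]
  simp only [Finset.sum_add_distrib, h1, hG.sum_mul_christoffel hy]
  rw [h k b, h k a, h b a]
  ring

/-- Raising an index commutes with covariant differentiation. -/
theorem covDeriv_raise (hG : IsMetricOn G U) (hy : y ∈ U)
    {η : Fin n → EuclideanSpace ℝ (Fin n) → ℝ} (hη : ∀ j, ContDiffOn ℝ 1 (η j) U) (i k : Fin n) :
    covDeriv G (raise G η) i k y =
      ∑ j, (G y)⁻¹ i j * (pd k (η j) y - ∑ l, christoffel G l k j y * η l y) := by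
  have hlower : ∀ z ∈ U, ∀ j, η j z = ∑ m, G z j m * raise G η m z := fun z hz j =>
    (hG.sum_mul_sum_inv hz (fun j => η j z) j).symm
  rw [← hG.sum_inv_mul_sum hy (fun m => covDeriv G (raise G η) m k y) i]
  refine Finset.sum_congr rfl fun j _ => congrArg _ ?_
  -- The derivative of `η_j = h_jm η^m` avoids differentiating the inverse matrix.
  rw [pd_congr hG.isOpen hy (fun z hz => hlower z hz j), pd_sum_mul
    (fun m => hG.differentiableAt (hG.contDiffOn j m) hy (by norm_num))
    (fun m => hG.differentiableAt (hG.contDiffOn_raise (by norm_num) hη m) hy (by norm_num))]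
  simp only [hG.pd_metric hy, hlower y hy, covDeriv, Finset.sum_add_distrib, mul_add,
    Finset.mul_sum, Finset.sum_mul, add_mul]
  rw [Finset.sum_comm (f := fun l m => christoffel G l k j y * (G y l m * raise G η m y)),
    Finset.sum_comm (f := fun m l => G y j m * (christoffel G m k l y * raise G η l y))]
  simp only [mul_assoc]
  ring

/-- The contracted Ricci identity `∇_i ∇_l X^i = ∇_l ∇_i X^i + R_lm X^m`. -/
theorem div_covDeriv (hG : IsMetricOn G U) (hy : y ∈ U)
    {X : Fin n → EuclideanSpace ℝ (Fin n) → ℝ} (hX : ∀ j, ContDiffOn ℝ 2 (X j) U) (l : Fin n) :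
    ∑ i, (pd i (covDeriv G X i l) y + ∑ m, christoffel G i i m y * covDeriv G X m l y -
        ∑ m, christoffel G m i l y * covDeriv G X i m y) =
      pd l (fun z => ∑ i, covDeriv G X i i z) y + ∑ m, ricciCoord G y m l * X m y := by
  have hX1 : ∀ j, DifferentiableAt ℝ (X j) y := fun j =>
    hG.differentiableAt (hX j) hy (by norm_num)
  have hpX : ∀ k j, DifferentiableAt ℝ (pd k (X j)) y := fun k j =>
    hG.differentiableAt (contDiffOn_pd (m := 1) hG.isOpen (hX j) (by norm_num) k) hy (by norm_num)
  have hΓ : ∀ a b c, DifferentiableAt ℝ (christoffel G a b c) y := fun a b c =>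
    hG.differentiableAt (hG.contDiffOn_christoffel a b c) hy (by norm_num)
  have hA : ∀ a i k, pd a (covDeriv G X i k) y = pd a (pd k (X i)) y +
      ∑ p, (pd a (christoffel G i k p) y * X p y + christoffel G i k p y * pd a (X p) y) := by
    intro a i k
    rw [← pd_sum_mul (hΓ i k) hX1, ← pd_add (hpX k i)
      (DifferentiableAt.fun_sum fun p _ => (hΓ i k p).fun_mul (hX1 p))]
    rfl
  rw [pd_sum fun i => hG.differentiableAt (hG.contDiffOn_covDeriv hX i i) hy (by norm_num)]
  simp only [hA, covDeriv, ricciCoord, Matrix.of_apply, pd_comm hG.isOpen hy (hX _) l]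
  simp only [Finset.sum_add_distrib, Finset.sum_sub_distrib, mul_add, add_mul, sub_mul,
    Finset.mul_sum, Finset.sum_mul]
  have e1 : ∑ i, ∑ p, pd i (christoffel G i l p) y * X p y =
      ∑ p, ∑ i, pd i (christoffel G i p l) y * X p y := by
    rw [Finset.sum_comm]
    have : ∀ i p, christoffel G i l p = christoffel G i p l := fun i p =>
      funext (hG.christoffel_symm i l p)
    simp only [this]
  have e2 : ∑ i, ∑ p, christoffel G i l p y * pd i (X p) y =
      ∑ i, ∑ m, christoffel G m i l y * pd m (X i) y := by
    rw [Finset.sum_comm]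
    simp only [hG.christoffel_symm _ l]
  have e3 : ∑ i, ∑ p, pd l (christoffel G i i p) y * X p y =
      ∑ p, ∑ i, pd l (christoffel G i p i) y * X p y := by
    rw [Finset.sum_comm]
    have : ∀ i p, christoffel G i i p = christoffel G i p i := fun i p =>
      funext (hG.christoffel_symm i i p)
    simp only [this]
  have e4 : ∑ i, ∑ m, ∑ p, christoffel G i i m y * (christoffel G m l p y * X p y) =
      ∑ p, ∑ i, ∑ m, christoffel G i i m y * christoffel G m p l y * X p y := by
    rw [Finset.sum_comm_cycle]
    simp only [hG.christoffel_symm _ l, mul_assoc]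
  have e5 : ∑ i, ∑ m, ∑ p, christoffel G m i l y * (christoffel G i m p y * X p y) =
      ∑ p, ∑ m, ∑ i, christoffel G m l i y * christoffel G i p m y * X p y := by
    rw [Finset.sum_comm_cycle]
    refine Finset.sum_congr rfl fun p _ => ?_
    rw [Finset.sum_comm]
    simp only [hG.christoffel_symm _ l, hG.christoffel_symm _ p, mul_assoc]
  rw [e1, e2, e3, e4, e5]
  ring

end IsMetricOn

end Coordinates

/-! ### The identity in coordinates -/

section Coordinates

variable {n : ℕ} {G : EuclideanSpace ℝ (Fin n) → Matrix (Fin n) (Fin n) ℝ}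
  {U : Set (EuclideanSpace ℝ (Fin n))} {y : EuclideanSpace ℝ (Fin n)}

/-- The coordinate expression of `W = u ^ 2 - |∇u|² - 1`. -/
noncomputable def coordW (G : EuclideanSpace ℝ (Fin n) → Matrix (Fin n) (Fin n) ℝ)
    (u : EuclideanSpace ℝ (Fin n) → ℝ) (z : EuclideanSpace ℝ (Fin n)) : ℝ :=
  u z * u z - ∑ j, pd j u z * raise G (fun i => pd i u) j z - 1

namespace IsMetricOn

theorem hessianCoord_symm (hG : IsMetricOn G U) (hy : y ∈ U)
    {u : EuclideanSpace ℝ (Fin n) → ℝ} (hu : ContDiffOn ℝ 2 u U) (i j : Fin n) :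
    hessianCoord G u y i j = hessianCoord G u y j i := by
  simp only [hessianCoord, Matrix.of_apply, pd_comm hG.isOpen hy hu i j,
    hG.christoffel_symm _ i j]

theorem covDeriv_raise_pd (hG : IsMetricOn G U) (hy : y ∈ U)
    {u : EuclideanSpace ℝ (Fin n) → ℝ} (hu : ContDiffOn ℝ 2 u U) (i k : Fin n) :
    covDeriv G (raise G fun j => pd j u) i k y =
      ∑ j, (G y)⁻¹ i j * hessianCoord G u y k j :=
  hG.covDeriv_raise hy (fun j => contDiffOn_pd hG.isOpen hu (by norm_num) j) i k

theorem contDiffOn_coordW (hG : IsMetricOn G U)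
    {u : EuclideanSpace ℝ (Fin n) → ℝ} (hu : ContDiffOn ℝ 3 u U) :
    ContDiffOn ℝ 2 (coordW G u) U := by
  have hu2 : ContDiffOn ℝ 2 u U := hu.of_le (by norm_num)
  have hp : ∀ j, ContDiffOn ℝ 2 (pd j u) U := fun j =>
    contDiffOn_pd hG.isOpen hu (by norm_num) j
  exact ((hu2.mul hu2).sub (ContDiffOn.sum fun j _ =>
    (hp j).mul (hG.contDiffOn_raise le_rfl hp j))).sub contDiffOn_const

/-- `∇W = 2 u ∇u - 2 ∇²u(∇u)`, as a 1-form. -/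
theorem pd_coordW (hG : IsMetricOn G U) (hy : y ∈ U)
    {u : EuclideanSpace ℝ (Fin n) → ℝ} (hu : ContDiffOn ℝ 3 u U) (k : Fin n) :
    pd k (coordW G u) y = 2 * (u y * pd k u y) -
      2 * ∑ l, hessianCoord G u y k l * raise G (fun i => pd i u) l y := by
  have hp : ∀ j, ContDiffOn ℝ 2 (pd j u) U := fun j =>
    contDiffOn_pd hG.isOpen hu (by norm_num) j
  have hu1 : DifferentiableAt ℝ u y := hG.differentiableAt hu hy (by norm_num)
  have hp1 : ∀ j, DifferentiableAt ℝ (pd j u) y := fun j =>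
    hG.differentiableAt (hp j) hy (by norm_num)
  have hX1 : ∀ j, DifferentiableAt ℝ (raise G (fun i => pd i u) j) y := fun j =>
    hG.differentiableAt (hG.contDiffOn_raise le_rfl hp j) hy (by norm_num)
  have hS : DifferentiableAt ℝ
      (fun z => ∑ j, pd j u z * raise G (fun i => pd i u) j z) y :=
    DifferentiableAt.fun_sum fun j _ => (hp1 j).fun_mul (hX1 j)
  have hpX : ∀ j, pd k (raise G (fun i => pd i u) j) y =
      (∑ m, (G y)⁻¹ j m * hessianCoord G u y k m) -
        ∑ l, christoffel G j k l y * raise G (fun i => pd i u) l y := fun j => by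
    rw [← hG.covDeriv_raise_pd hy (hu.of_le (by norm_num)), covDeriv]
    ring
  have hconst : pd k (fun _ => (1 : ℝ)) y = 0 := by simp [pd]
  have e1 : ∑ j, pd j u y * ∑ m, (G y)⁻¹ j m * hessianCoord G u y k m =
      ∑ m, hessianCoord G u y k m * raise G (fun i => pd i u) m y := by
    simp only [raise, Finset.mul_sum]
    rw [Finset.sum_comm]
    refine Finset.sum_congr rfl fun m _ => Finset.sum_congr rfl fun j _ => ?_
    rw [hG.inv_symm y j m]
    ring
  have e2 : ∑ j, pd j u y * ∑ l, christoffel G j k l y * raise G (fun i => pd i u) l y =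
      ∑ l, (pd k (pd l u) y - hessianCoord G u y k l) * raise G (fun i => pd i u) l y := by
    simp only [hessianCoord, Matrix.of_apply, sub_sub_cancel, Finset.mul_sum, Finset.sum_mul]
    rw [Finset.sum_comm]
    exact Finset.sum_congr rfl fun m _ => Finset.sum_congr rfl fun j _ => by ring
  change pd k (fun z => u z * u z - ∑ j, pd j u z * raise G (fun i => pd i u) j z - 1) y = _
  rw [pd_sub ((hu1.fun_mul hu1).fun_sub hS) (differentiableAt_const _),
    pd_sub (hu1.fun_mul hu1) hS, pd_mul hu1 hu1, pd_sum_mul hp1 hX1, hconst]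
  simp only [hpX, mul_sub, Finset.sum_add_distrib, Finset.sum_sub_distrib, e1, e2, sub_mul]
  ring

/-- `∇W = 2 u ∇u - 2 ∇_{∇u} ∇u`, as a vector field. -/
theorem raise_pd_coordW (hG : IsMetricOn G U) (hy : y ∈ U)
    {u : EuclideanSpace ℝ (Fin n) → ℝ} (hu : ContDiffOn ℝ 3 u U) (i : Fin n) :
    raise G (fun j => pd j (coordW G u)) i y =
      2 * (u y * raise G (fun j => pd j u) i y) -
        2 * ∑ l, covDeriv G (raise G fun j => pd j u) i l y * raise G (fun j => pd j u) l y := by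
  have hu2 : ContDiffOn ℝ 2 u U := hu.of_le (by norm_num)
  simp only [hG.covDeriv_raise_pd hy hu2, Finset.sum_mul]
  rw [Finset.sum_comm, raise]
  simp only [hG.pd_coordW hy hu, mul_sub, Finset.sum_sub_distrib]
  congr 1
  · rw [raise, Finset.mul_sum, Finset.mul_sum]
    exact Finset.sum_congr rfl fun j _ => by ring
  · simp only [Finset.mul_sum, hG.hessianCoord_symm hy hu2]
    refine Finset.sum_congr rfl fun j _ => Finset.sum_congr rfl fun l _ => ?_
    rw [hG.hessianCoord_symm hy hu2 j l]
    ring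

/-- The Laplacian of `f` is the divergence of its gradient. -/
theorem sum_inv_mul_hessianCoord (hG : IsMetricOn G U) (hy : y ∈ U)
    {f : EuclideanSpace ℝ (Fin n) → ℝ} (hf : ContDiffOn ℝ 2 f U) :
    ∑ i, ∑ j, (G y)⁻¹ i j * hessianCoord G f y i j =
      ∑ i, covDeriv G (raise G fun j => pd j f) i i y := by
  simp only [hG.covDeriv_raise_pd hy hf]

/-- The divergence of `∇W` for arbitrary `u`, in terms of the divergence of the endomorphism
`∇X`, `X = ∇u`. -/
theorem div_raise_pd_coordW (hG : IsMetricOn G U) (hy : y ∈ U)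
    {u : EuclideanSpace ℝ (Fin n) → ℝ} (hu : ContDiffOn ℝ 3 u U) :
    ∑ i, covDeriv G (raise G fun j => pd j (coordW G u)) i i y =
      2 * ∑ i, pd i u y * raise G (fun j => pd j u) i y +
      2 * (u y * ∑ i, covDeriv G (raise G fun j => pd j u) i i y) -
      2 * ∑ l, (∑ i, (pd i (covDeriv G (raise G fun j => pd j u) i l) y +
          ∑ m, christoffel G i i m y * covDeriv G (raise G fun j => pd j u) m l y -
          ∑ m, christoffel G m i l y * covDeriv G (raise G fun j => pd j u) i m y)) *
        raise G (fun j => pd j u) l y -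
      2 * ∑ i, ∑ l, covDeriv G (raise G fun j => pd j u) i l y *
        covDeriv G (raise G fun j => pd j u) l i y := by
  have hp : ∀ j, ContDiffOn ℝ 2 (pd j u) U := fun j =>
    contDiffOn_pd hG.isOpen hu (by norm_num) j
  have hXc := fun j => hG.contDiffOn_raise le_rfl hp j
  have hu1 : DifferentiableAt ℝ u y := hG.differentiableAt hu hy (by norm_num)
  have hY := fun z (hz : z ∈ U) i => hG.raise_pd_coordW hz hu i
  set X := raise G fun j => pd j u
  have hX1 : ∀ j, DifferentiableAt ℝ (X j) y := fun j =>
    hG.differentiableAt (hXc j) hy (by norm_num)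
  have hA1 : ∀ i l, DifferentiableAt ℝ (covDeriv G X i l) y := fun i l =>
    hG.differentiableAt (hG.contDiffOn_covDeriv hXc i l) hy (by norm_num)
  have hpX : ∀ l i, pd i (X l) y = covDeriv G X l i y - ∑ m, christoffel G l i m y * X m y :=
    fun l i => by rw [covDeriv]; ring
  have hpY : ∀ i, pd i (raise G (fun j => pd j (coordW G u)) i) y =
      2 * (pd i u y * X i y + u y * pd i (X i) y) -
        2 * ∑ l, (pd i (covDeriv G X i l) y * X l y +
          covDeriv G X i l y * pd i (X l) y) := by
    intro i
    have hS : DifferentiableAt ℝ (fun z => ∑ l, covDeriv G X i l z * X l z) y :=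
      DifferentiableAt.fun_sum fun l _ => (hA1 i l).fun_mul (hX1 l)
    rw [pd_congr hG.isOpen hy (fun z hz => hY z hz i),
      pd_sub ((hu1.fun_mul (hX1 i)).const_mul 2) (hS.const_mul 2),
      pd_const_mul 2 (hu1.fun_mul (hX1 i)), pd_const_mul 2 hS, pd_mul hu1 (hX1 i),
      pd_sum_mul (hA1 i) hX1]
  have hdiv : ∀ i, covDeriv G (raise G fun j => pd j (coordW G u)) i i y =
      2 * (pd i u y * X i y) + 2 * (u y * covDeriv G X i i y) -
      2 * ∑ l, pd i (covDeriv G X i l) y * X l y -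
      2 * ∑ l, covDeriv G X i l y * covDeriv G X l i y +
      2 * (∑ l, ∑ m, covDeriv G X i l y * (christoffel G l i m y * X m y)) -
      2 * (∑ m, ∑ l, christoffel G i i m y * (covDeriv G X m l y * X l y)) := by
    intro i
    rw [covDeriv, hpY]
    simp only [hpX, hY y hy, mul_sub, Finset.sum_sub_distrib, Finset.sum_add_distrib,
      Finset.mul_sum]
    simp only [mul_left_comm (christoffel G _ _ _ y) (2 : ℝ), ← Finset.mul_sum,
      mul_left_comm (christoffel G _ _ _ y) (u y)]
    ring
  simp only [hdiv]
  simp only [Finset.sum_add_distrib, Finset.sum_sub_distrib, add_mul, sub_mul, ← Finset.mul_sum]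
  have e1 : ∑ l, (∑ i, pd i (covDeriv G X i l) y) * X l y =
      ∑ i, ∑ l, pd i (covDeriv G X i l) y * X l y := by
    simp only [Finset.sum_mul]
    exact Finset.sum_comm
  have e2 : ∑ l, (∑ i, ∑ m, christoffel G i i m y * covDeriv G X m l y) * X l y =
      ∑ i, ∑ m, christoffel G i i m y * ∑ l, covDeriv G X m l y * X l y := by
    simp only [Finset.sum_mul, Finset.mul_sum, mul_assoc]
    rw [Finset.sum_comm_cycle, Finset.sum_comm_cycle]
  have e3 : ∑ l, (∑ i, ∑ m, christoffel G m i l y * covDeriv G X i m y) * X l y =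
      ∑ i, ∑ l, covDeriv G X i l y * ∑ m, christoffel G l i m y * X m y := by
    simp only [Finset.sum_mul, Finset.mul_sum]
    rw [Finset.sum_comm]
    refine Finset.sum_congr rfl fun i _ => ?_
    rw [Finset.sum_comm]
    exact Finset.sum_congr rfl fun l _ => Finset.sum_congr rfl fun m _ => by ring
  rw [e1, e2, e3]
  ring

/-- The squared norm of a symmetric tensor `T = H - c h` in terms of the endomorphism `h⁻¹ H`. -/
theorem sum_inv_mul_inv_mul (hG : IsMetricOn G U) (hy : y ∈ U)
    {H : Matrix (Fin n) (Fin n) ℝ} (hH : ∀ i j, H i j = H j i) (c : ℝ) :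
    (∑ i, ∑ j, ∑ k, ∑ l, (G y)⁻¹ i k * (G y)⁻¹ j l * (H - c • G y) i j * (H - c • G y) k l) =
      (∑ i, ∑ l, (∑ j, (G y)⁻¹ i j * H l j) * ∑ j, (G y)⁻¹ l j * H i j) -
        2 * (c * ∑ i, ∑ j, (G y)⁻¹ i j * H i j) + n * (c * c) := by
  have hA : ∀ i l, ∑ j, (G y)⁻¹ i j * H l j = ((G y)⁻¹ * H) i l := fun i l => by
    rw [Matrix.mul_apply]
    exact Finset.sum_congr rfl fun j _ => by rw [hH]
  have hT : ∀ i j, (H - c • G y) i j = (H - c • G y) j i := fun i j => by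
    simp [hH i j, hG.symm y i j]
  have hB : (G y)⁻¹ * (H - c • G y) = (G y)⁻¹ * H - c • (1 : Matrix (Fin n) (Fin n) ℝ) := by
    rw [mul_sub, mul_smul_comm, Matrix.nonsing_inv_mul _ (hG.isUnit_det y hy)]
  have hL : (∑ i, ∑ j, ∑ k, ∑ l,
      (G y)⁻¹ i k * (G y)⁻¹ j l * (H - c • G y) i j * (H - c • G y) k l) =
      (((G y)⁻¹ * (H - c • G y)) * ((G y)⁻¹ * (H - c • G y))).trace := by
    generalize H - c • G y = T at hT
    simp only [Matrix.trace, Matrix.diag_apply, Matrix.mul_apply, Finset.sum_mul, Finset.mul_sum]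
    -- Both sides run over the same four indices; only their order differs.
    have : ∀ i j, (∑ k, ∑ l, (G y)⁻¹ i k * (G y)⁻¹ j l * T i j * T k l) =
        ∑ l, ∑ k, (G y)⁻¹ i k * T k l * ((G y)⁻¹ l j * T j i) := fun i j => by
      rw [Finset.sum_comm]
      refine Finset.sum_congr rfl fun l _ => Finset.sum_congr rfl fun k _ => ?_
      rw [hG.inv_symm y j l, hT i j]
      ring
    simp only [this]
    refine Finset.sum_congr rfl fun i _ => ?_
    rw [Finset.sum_comm]
  rw [hL, hB]
  simp only [hA]
  have e1 : ∑ i, ∑ l, ((G y)⁻¹ * H) i l * ((G y)⁻¹ * H) l i =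
      (((G y)⁻¹ * H) * ((G y)⁻¹ * H)).trace := by
    simp [Matrix.trace, Matrix.mul_apply]
  have e2 : ∑ i, ((G y)⁻¹ * H) i i = ((G y)⁻¹ * H).trace := rfl
  rw [e1, e2, sub_mul, mul_sub, mul_sub]
  simp [Matrix.trace_sub]
  ring

/-- The identity for `W` in coordinates. -/
theorem laplacian_coordW (hG : IsMetricOn G U) (hy : y ∈ U)
    {u : EuclideanSpace ℝ (Fin n) → ℝ} (hu : ContDiffOn ℝ 3 u U) (hu0 : 0 < u y)
    (hlap : ∀ z ∈ U, ∑ i, ∑ j, (G z)⁻¹ i j * hessianCoord G u z i j = n * u z)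
    (hric : ricciCoord G y + (n : ℝ) • G y = (u y)⁻¹ • hessianCoord G u y) :
    -(∑ i, ∑ j, (G y)⁻¹ i j * hessianCoord G (coordW G u) y i j) =
      2 * (∑ i, ∑ j, ∑ k, ∑ l, (G y)⁻¹ i k * (G y)⁻¹ j l *
        (hessianCoord G u y - u y • G y) i j * (hessianCoord G u y - u y • G y) k l) -
      (u y)⁻¹ * ∑ k, pd k (coordW G u) y * raise G (fun j => pd j u) k y := by
  have hu2 : ContDiffOn ℝ 2 u U := hu.of_le (by norm_num)
  have hp : ∀ j, ContDiffOn ℝ 2 (pd j u) U := fun j =>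
    contDiffOn_pd hG.isOpen hu (by norm_num) j
  have hXc := fun j => hG.contDiffOn_raise le_rfl hp j
  have htr : ∀ z ∈ U, ∑ i, covDeriv G (raise G fun j => pd j u) i i z = n * u z :=
    fun z hz => by rw [← hG.sum_inv_mul_hessianCoord hz hu2, hlap z hz]
  have hlower : ∀ l, ∑ m, G y l m * raise G (fun j => pd j u) m y = pd l u y := fun l =>
    hG.sum_mul_sum_inv hy (fun j => pd j u y) l
  -- The two static equations turn the divergence of `∇X` into `u⁻¹ ∇²u(X)`.
  have hdivA : ∀ l, ∑ i, (pd i (covDeriv G (raise G fun j => pd j u) i l) y +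
        ∑ m, christoffel G i i m y * covDeriv G (raise G fun j => pd j u) m l y -
        ∑ m, christoffel G m i l y * covDeriv G (raise G fun j => pd j u) i m y) =
      (u y)⁻¹ * ∑ m, hessianCoord G u y l m * raise G (fun j => pd j u) m y := by
    intro l
    have hR : ∀ m, ricciCoord G y m l =
        (u y)⁻¹ * hessianCoord G u y l m - n * G y l m := fun m => by
      have := congrFun (congrFun hric m) l
      simp only [Matrix.add_apply, Matrix.smul_apply, smul_eq_mul] at this
      rw [hG.hessianCoord_symm hy hu2 l m, hG.symm y l m]
      linarith
    rw [hG.div_covDeriv hy hXc l, pd_congr hG.isOpen hy htr,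
      pd_const_mul _ (hG.differentiableAt hu hy (by norm_num)), ← hlower l]
    simp only [hR, sub_mul, Finset.sum_sub_distrib, mul_assoc, ← Finset.mul_sum]
    ring
  rw [hG.sum_inv_mul_hessianCoord hy (hG.contDiffOn_coordW hu), hG.div_raise_pd_coordW hy hu,
    hG.sum_inv_mul_inv_mul hy (hG.hessianCoord_symm hy hu2), htr y hy, hlap y hy]
  simp only [hdivA]
  simp only [hG.pd_coordW hy hu, sub_mul, Finset.sum_sub_distrib,
    hG.covDeriv_raise_pd hy hu2]
  simp only [mul_assoc, ← Finset.mul_sum]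
  field_simp
  ring

end IsMetricOn

end Coordinates

/-! ### From the manifold to a chart -/

section Manifold

variable {n : ℕ} {M : Type*} [TopologicalSpace M] [ChartedSpace (EuclideanSpace ℝ (Fin n)) M]
  {e : OpenPartialHomeomorph M (EuclideanSpace ℝ (Fin n))}

theorem mdifferentiable_of_mem_maximalAtlas (he : e ∈ IsManifold.maximalAtlas (𝓡 n) ∞ M) :
    e.MDifferentiable (𝓡 n) (𝓡 n) :=
  ⟨(contMDiffOn_of_mem_maximalAtlas he).mdifferentiableOn (by simp),
    (contMDiffOn_symm_of_mem_maximalAtlas he).mdifferentiableOn (by simp)⟩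

/-- The coordinate frame `∂_1, …, ∂_n` of the chart `e` at the point with coordinates `y`. -/
noncomputable def coordBasis (he : e ∈ IsManifold.maximalAtlas (𝓡 n) ∞ M)
    {y : EuclideanSpace ℝ (Fin n)} (hy : y ∈ e.target) :
    Module.Basis (Fin n) ℝ (TangentSpace (𝓡 n) (e.symm y)) :=
  (EuclideanSpace.basisFun (Fin n) ℝ).toBasis.map
    ((mdifferentiable_of_mem_maximalAtlas he).symm.mfderiv hy).toLinearEquiv

theorem coordBasis_apply (he : e ∈ IsManifold.maximalAtlas (𝓡 n) ∞ M)
    {y : EuclideanSpace ℝ (Fin n)} (hy : y ∈ e.target) (i : Fin n) :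
    coordBasis he hy i =
      mfderiv (𝓡 n) (𝓡 n) e.symm y (EuclideanSpace.single i (1 : ℝ)) := by
  have : coordBasis he hy i =
      mfderiv (𝓡 n) (𝓡 n) e.symm y ((EuclideanSpace.basisFun (Fin n) ℝ).toBasis i) := by
    exact Module.Basis.map_apply _ _ _
  rw [this, OrthonormalBasis.coe_toBasis, EuclideanSpace.basisFun_apply]

theorem mfderiv_coordBasis (he : e ∈ IsManifold.maximalAtlas (𝓡 n) ∞ M)
    {y : EuclideanSpace ℝ (Fin n)} (hy : y ∈ e.target) {f : M → ℝ}
    (hf : MDifferentiableAt (𝓡 n) 𝓘(ℝ, ℝ) f (e.symm y)) (i : Fin n) :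
    mfderiv (𝓡 n) 𝓘(ℝ, ℝ) f (e.symm y) (coordBasis he hy i) = pd i (f ∘ e.symm) y := by
  have hc : mfderiv (𝓡 n) 𝓘(ℝ, ℝ) (f ∘ e.symm) y = _ :=
    mfderiv_comp y hf ((mdifferentiable_of_mem_maximalAtlas he).mdifferentiableAt_symm hy)
  rw [coordBasis_apply, pd, ← mfderiv_eq_fderiv, hc]
  rfl

theorem contDiffOn_comp_symm (he : e ∈ IsManifold.maximalAtlas (𝓡 n) ∞ M) {f : M → ℝ}
    {m : ℕ} (hf : ContMDiff (𝓡 n) 𝓘(ℝ, ℝ) m f) : ContDiffOn ℝ m (f ∘ e.symm) e.target :=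
  (hf.comp_contMDiffOn ((contMDiffOn_symm_of_mem_maximalAtlas he).of_le
    (by exact_mod_cast le_top))).contDiffOn

variable [IsManifold (𝓡 n) ∞ M]

theorem metricCoord_eq (h : Metric n M) (he : e ∈ IsManifold.maximalAtlas (𝓡 n) ∞ M)
    {y : EuclideanSpace ℝ (Fin n)} (hy : y ∈ e.target) (i j : Fin n) :
    metricCoord h e y i j = h.inner (e.symm y) (coordBasis he hy i) (coordBasis he hy j) := by
  rw [coordBasis_apply, coordBasis_apply]
  rfl

theorem inner_sum_coordBasis (h : Metric n M) (he : e ∈ IsManifold.maximalAtlas (𝓡 n) ∞ M)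
    {y : EuclideanSpace ℝ (Fin n)} (hy : y ∈ e.target) (c : Fin n → ℝ) (i : Fin n) :
    h.inner (e.symm y) (coordBasis he hy i) (∑ j, c j • coordBasis he hy j) =
      ∑ j, metricCoord h e y i j * c j := by
  simp only [map_sum, map_smul, smul_eq_mul, metricCoord_eq h he hy, mul_comm]

theorem isUnit_det_metricCoord (h : Metric n M) (he : e ∈ IsManifold.maximalAtlas (𝓡 n) ∞ M)
    {y : EuclideanSpace ℝ (Fin n)} (hy : y ∈ e.target) : IsUnit (metricCoord h e y).det := by
  rw [isUnit_iff_ne_zero]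
  intro hdet
  obtain ⟨c, hc, hGc⟩ := Matrix.exists_mulVec_eq_zero_iff.2 hdet
  have hne : ∑ j, c j • coordBasis he hy j ≠ 0 := fun h0 => hc <| funext <|
    Fintype.linearIndependent_iff.1 (coordBasis he hy).linearIndependent c h0
  have hz : ∀ i, h.inner (e.symm y) (coordBasis he hy i) (∑ j, c j • coordBasis he hy j) = 0 :=
    fun i => (inner_sum_coordBasis h he hy c i).trans (congrFun hGc i)
  refine (h.pos _ _ hne).ne' ?_
  rw [h.symm, map_sum]
  exact Finset.sum_eq_zero fun i _ => by rw [map_smul, h.symm, hz, smul_zero]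

theorem contMDiffOn_coordField (he : e ∈ IsManifold.maximalAtlas (𝓡 n) ∞ M) (i : Fin n) :
    ContMDiffOn (𝓡 n) (𝓡 n).tangent 2
      (fun y => (TotalSpace.mk' (EuclideanSpace ℝ (Fin n)) (e.symm y)
        (mfderiv (𝓡 n) (𝓡 n) e.symm y (EuclideanSpace.single i (1 : ℝ))) :
          TangentBundle (𝓡 n) M)) e.target := by
  have hT := (contMDiffOn_symm_of_mem_maximalAtlas he).contMDiffOn_tangentMapWithin
    (m := 2) (by norm_cast) e.open_target.uniqueMDiffOn
  have hs : ContMDiffOn (𝓡 n) (𝓡 n).tangent 2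
      (fun y => (⟨y, EuclideanSpace.single i (1 : ℝ)⟩ :
        TangentBundle (𝓡 n) (EuclideanSpace ℝ (Fin n)))) e.target :=
    contMDiffOn_vectorSpace_iff_contDiffOn.2 contDiffOn_const
  refine (hT.comp hs fun y hy => hy).congr fun y hy => ?_
  simp only [Function.comp, tangentMapWithin]
  rw [mfderivWithin_of_isOpen e.open_target hy]

theorem isMetricOn_metricCoord (h : Metric n M)
    (he : e ∈ IsManifold.maximalAtlas (𝓡 n) ∞ M) : IsMetricOn (metricCoord h e) e.target where
  isOpen := e.open_target
  contDiffOn i j := by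
    have hh : ContMDiffOn (𝓡 n) ((𝓡 n).prod 𝓘(ℝ, EuclideanSpace ℝ (Fin n) →L[ℝ]
        EuclideanSpace ℝ (Fin n) →L[ℝ] ℝ)) 2
        (fun y => TotalSpace.mk' (EuclideanSpace ℝ (Fin n) →L[ℝ] EuclideanSpace ℝ (Fin n) →L[ℝ] ℝ)
          (E := fun p : M => TangentSpace (𝓡 n) p →L[ℝ] TangentSpace (𝓡 n) p →L[ℝ] ℝ)
          (e.symm y) (h.inner (e.symm y))) e.target :=
      h.contMDiff.comp_contMDiffOn
        ((contMDiffOn_symm_of_mem_maximalAtlas he).of_le (by norm_cast))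
    have := hh.clm_bundle_apply₂ (F₃ := ℝ) (E₃ := Bundle.Trivial M ℝ)
      (contMDiffOn_coordField he i) (contMDiffOn_coordField he j)
    intro y hy
    have := this y hy
    simp only [contMDiffWithinAt_totalSpace] at this
    exact this.2.contDiffWithinAt
  symm y i j := h.symm _ _ _
  isUnit_det y hy := isUnit_det_metricCoord h he hy

/-- In coordinates, the gradient is the differential with its index raised. -/
theorem grad_eq (h : Metric n M) (he : e ∈ IsManifold.maximalAtlas (𝓡 n) ∞ M)
    {y : EuclideanSpace ℝ (Fin n)} (hy : y ∈ e.target) {f : M → ℝ}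
    (hf : MDifferentiableAt (𝓡 n) 𝓘(ℝ, ℝ) f (e.symm y)) :
    grad h f (e.symm y) =
      ∑ j, raise (metricCoord h e) (fun i => pd i (f ∘ e.symm)) j y • coordBasis he hy j := by
  refine (LinearEquiv.symm_apply_eq _).2 <| (coordBasis he hy).ext fun i => ?_
  change mfderiv (𝓡 n) 𝓘(ℝ, ℝ) f (e.symm y) (coordBasis he hy i) = h.inner (e.symm y) _ _
  rw [h.symm, inner_sum_coordBasis h he hy, mfderiv_coordBasis he hy hf]
  exact ((isMetricOn_metricCoord h he).sum_mul_sum_inv hy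
    (fun i => pd i (f ∘ e.symm) y) i).symm

theorem inner_grad_grad (h : Metric n M) (he : e ∈ IsManifold.maximalAtlas (𝓡 n) ∞ M)
    {y : EuclideanSpace ℝ (Fin n)} (hy : y ∈ e.target) {f g : M → ℝ}
    (hf : MDifferentiableAt (𝓡 n) 𝓘(ℝ, ℝ) f (e.symm y))
    (hg : MDifferentiableAt (𝓡 n) 𝓘(ℝ, ℝ) g (e.symm y)) :
    h.inner (e.symm y) (grad h f (e.symm y)) (grad h g (e.symm y)) =
      ∑ j, pd j (g ∘ e.symm) y *
        raise (metricCoord h e) (fun i => pd i (f ∘ e.symm)) j y := by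
  rw [h.symm, inner_grad, grad_eq h he hy hf, map_sum]
  refine Finset.sum_congr rfl fun j _ => ?_
  rw [map_smul, mfderiv_coordBasis he hy hg, mul_comm]
  rfl

/-- In a chart, `W` is `coordW`. -/
theorem W_comp_symm (h : Metric n M) (he : e ∈ IsManifold.maximalAtlas (𝓡 n) ∞ M)
    {V : M → ℝ} (hV : ∀ p, 0 < V p)
    (hf : ContMDiff (𝓡 n) 𝓘(ℝ, ℝ) 3 fun q => √(V q))
    {y : EuclideanSpace ℝ (Fin n)} (hy : y ∈ e.target) :
    (W h V ∘ e.symm) y = coordW (metricCoord h e) ((fun q => √(V q)) ∘ e.symm) y := by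
  have hd := hf.mdifferentiableAt (x := e.symm y) (by norm_num)
  rw [Function.comp_apply, W, inner_grad_grad h he hy hd hd, coordW, Function.comp_apply,
    Real.mul_self_sqrt (hV _).le]

theorem contMDiff_of_contDiffOn_comp_symm {f : M → ℝ} {m : ℕ}
    (hf : ∀ e ∈ IsManifold.maximalAtlas (𝓡 n) ∞ M, ContDiffOn ℝ m (f ∘ e.symm) e.target) :
    ContMDiff (𝓡 n) 𝓘(ℝ, ℝ) m f := by
  intro p
  have he := IsManifold.chart_mem_maximalAtlas (I := 𝓡 n) (n := ∞) p
  have hp := mem_chart_source (EuclideanSpace ℝ (Fin n)) p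
  have hc := (hf _ he).contMDiffOn.comp ((contMDiffOn_of_mem_maximalAtlas he).of_le
    (by exact_mod_cast le_top)) (fun q hq => (chartAt _ p).map_source hq)
  refine (hc.congr fun q hq => ?_).contMDiffAt ((chartAt _ p).open_source.mem_nhds hp)
  simp [(chartAt _ p).left_inv hq]

theorem contMDiff_W (h : Metric n M) {V : M → ℝ} (hV : ∀ p, 0 < V p)
    (hf : ContMDiff (𝓡 n) 𝓘(ℝ, ℝ) 3 fun q => √(V q)) :
    ContMDiff (𝓡 n) 𝓘(ℝ, ℝ) 2 (W h V) :=
  contMDiff_of_contDiffOn_comp_symm (m := 2) fun _ he =>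
    ((isMetricOn_metricCoord h he).contDiffOn_coordW (contDiffOn_comp_symm he (m := 3) hf)).congr
      fun _ hy => W_comp_symm h he hV hf hy

theorem hessianCoord_congr {G : EuclideanSpace ℝ (Fin n) → Matrix (Fin n) (Fin n) ℝ}
    {f g : EuclideanSpace ℝ (Fin n) → ℝ} {U : Set (EuclideanSpace ℝ (Fin n))} (hU : IsOpen U)
    (hfg : ∀ z ∈ U, f z = g z) {y : EuclideanSpace ℝ (Fin n)} (hy : y ∈ U) :
    hessianCoord G f y = hessianCoord G g y := by
  have hpd : ∀ z ∈ U, ∀ j, pd j f z = pd j g z := fun z hz j => pd_congr hU hz hfg j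
  ext i j
  simp only [hessianCoord, Matrix.of_apply, hpd y hy, pd_congr hU hy fun z hz => hpd z hz j]

end Manifold

end StaticSolution

theorem lemma3p1 {n : ℕ} {M : Type*} [TopologicalSpace M]
    [ChartedSpace (EuclideanSpace ℝ (Fin n)) M] [IsManifold (𝓡 n) ∞ M]
    (h : StaticSolution.Metric n M) (V : M → ℝ) (hV : StaticSolution.IsStatic h V) :
    ContMDiff (𝓡 n) 𝓘(ℝ, ℝ) 2 (StaticSolution.W h V) ∧
    ∀ e ∈ IsManifold.maximalAtlas (𝓡 n) ∞ M, ∀ p ∈ e.source,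
      -StaticSolution.laplacian h e (StaticSolution.W h V) p =
        2 * StaticSolution.tensorNormSq h e p
            (StaticSolution.hessian h e (fun q => √(V q)) p -
              √(V p) • StaticSolution.metricMatrix h e p) -
          h.inner p ((√(V p))⁻¹ • StaticSolution.grad h (fun q => √(V q)) p)
            (StaticSolution.grad h (StaticSolution.W h V) p) := by
  have hf : ContMDiff (𝓡 n) 𝓘(ℝ, ℝ) 3 fun q => √(V q) := fun p =>
    (Real.contDiffAt_sqrt (hV.pos p).ne').contMDiffAt.comp p (hV.contMDiff p)
  have hW := StaticSolution.contMDiff_W h hV.pos hf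
  refine ⟨hW, fun e he p hp => ?_⟩
  obtain ⟨y, hy, rfl⟩ : ∃ y ∈ e.target, e.symm y = p := ⟨e p, e.map_source hp, e.left_inv hp⟩
  have hG := StaticSolution.isMetricOn_metricCoord h he
  have hey : ∀ z ∈ e.target, e (e.symm z) = z := fun z hz => e.right_inv hz
  have hlap : ∀ z ∈ e.target, ∑ i, ∑ j, (StaticSolution.metricCoord h e z)⁻¹ i j *
      StaticSolution.hessianCoord (StaticSolution.metricCoord h e)
        ((fun q => √(V q)) ∘ e.symm) z i j = n * ((fun q => √(V q)) ∘ e.symm) z := fun z hz => by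
    have := hV.laplacian_eq e he (e.symm z) (e.map_target hz)
    simpa only [StaticSolution.laplacian, StaticSolution.metricMatrix, StaticSolution.hessian,
      hey z hz, Function.comp_apply] using! this
  have hric := hV.ricci_eq e he (e.symm y) (e.map_target hy)
  simp only [StaticSolution.ricci, StaticSolution.metricMatrix, StaticSolution.hessian,
    hey y hy] at hric
  have hWc : ∀ z ∈ e.target, (StaticSolution.W h V ∘ e.symm) z = _ := fun z hz =>
    StaticSolution.W_comp_symm h he hV.pos hf hz
  have key := hG.laplacian_coordW hy (StaticSolution.contDiffOn_comp_symm he (m := 3) hf)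
    (Real.sqrt_pos.2 (hV.pos (e.symm y))) hlap hric
  rw [map_smul, smul_apply, smul_eq_mul,
    StaticSolution.inner_grad_grad h he hy (hf.mdifferentiableAt (by norm_num))
      (hW.mdifferentiableAt (by norm_num))]
  simp only [StaticSolution.laplacian, StaticSolution.tensorNormSq, StaticSolution.metricMatrix,
    StaticSolution.hessian, hey y hy, StaticSolution.hessianCoord_congr e.open_target hWc hy,
    StaticSolution.pd_congr e.open_target hy hWc]
  exact key
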